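/- **Conventions.** Let $\lambda=(\lambda_1\ge\dots\ge\lambda_m)$ be a partition of $N$. A *filling* of the Young diagram of $\lambda$ places a positive integer in each box so that no integer is skipped; it has *content* $\mu=(\mu_1,\dots,\mu_M)$ if it uses exactly $\mu_v$ copies of $v$ for $1\le v\le M$ and no other values. A filling is *row-standard* if its rows strictly increase from left to right and *column-semistandard* if its columns weakly increase from top to bottom. A *semistandard Young tableau* is a filling that is both; $S(\lambda,\mu)$ is the set of those of shape $\lambda$ and content $\mu$. Let $\tau$ be a row-standard filling, let $i,j$ be entries of $\tau$ in two boxes of the same column, and let $i_k$, $j_k$ denote the entries exactly $k$ boxes to the right of $i$, $j$. Then $(i,j)$ is an *inversion pair* if $i<j$ and, for some $n\ge 0$, the entries $i_k,j_k$ exist and $i_k=j_k$ for all $1\le k\le n$, and either (a) $i_{n+1}$ or $j_{n+1}$ does not exist and $i$ appears below $j$, or (b) $i_{n+1}$ and $j_{n+1}$ exist and $i_{n+1}>j_{n+1}$. Inversion pairs are counted as pairs of boxes, and $\operatorname{inv}(\tau)$ is their number. The *standardization* $\operatorname{st}(\tau)$ is obtained by reordering each column of $\tau$ separately into weakly increasing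 order from top to bottom. For $T\in S(\lambda,\mu)$ let $S_k^T(\lambda,\mu)$ be the set of row-standard fillings $\tau$ of shape $\lambda$ and content $\mu$ with $\operatorname{inv}(\tau)=k$ and $\operatorname{st}(\tau)=T$. For $T\in S(\lambda,\mu)$ and an integer $k$ that occurs in the $j$-th column of $T$, let $$\operatorname{dep}_j(k)=\#\{\text{entries } b<k \text{ in column } j\}-\#\{\text{entries } c\le k\text{ in column } j+1\},$$ and for the entry $a_{ij}=k$ in row $i$ and column $j$ of $T$ put $\operatorname{dep}(a_{ij})=\operatorname{dep}_j(k)$ and $$\operatorname{depm}(a_{ij})=\#\{\text{entries above } a_{ij} \text{ in column } j\}-\#\{\text{entries } c\le k\text{ in column } j+1\},$$ where the second number is $0$ if there is no column $j+1$. Let $[p]_q=1+q+\dots+q^{p-1}$, $[p]_q!=[1]_q\cdots[p]_q$ and $\binom{a}{b}_q=\frac{[a]_q!}{[b]_q!\,[a-b]_q!}$. **Theorem.** Let $T\in S(\lambda,\mu)$ be a semistandard Young tableau. Then $0\le\operatorname{dep}(a_{ij})\le\operatorname{depm}(a_{ij})$ for all entries of $T$, the set $\bigcup_k S_k^T(\lambda,\mu)$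 is finite, and $$\chi^T(q)\;=\;\sum_k |S_k^T(\lambda,\mu)|\,q^k\;=\;\frac{\prod_{i,j}[\operatorname{depm}(a_{ij})+1]_q}{\prod_{i,j}[\operatorname{depm}(a_{ij})-\operatorname{dep}(a_{ij})+1]_q}\;=\;\prod_{j}\ \prod_{k}\binom{\operatorname{dep}_j(k)+c_{j,k}}{c_{j,k}}_q ,$$ where $j$ runs over the columns of $T$, $k$ over the distinct values in column $j$, and $c_{j,k}$ is the number of entries equal to $k$ in column $j$. -/

import Mathlib

open scoped PowerSeries

namespace InvTab

/-- A filling of the Young diagram `Y` (rows and columns are indexed from `0`): positive integers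
in the cells, such that no integer is skipped. For extensionality, the entry is `0` outside `Y`. -/
@[ext]
structure Filling (Y : YoungDiagram) where
  entry : ℕ → ℕ → ℕ
  pos : ∀ i j, (i, j) ∈ Y → 0 < entry i j
  zeros : ∀ i j, (i, j) ∉ Y → entry i j = 0
  noSkip : ∀ i j, (i, j) ∈ Y → ∀ v, 0 < v → v ≤ entry i j →
    ∃ i' j', (i', j') ∈ Y ∧ entry i' j' = v

variable {Y : YoungDiagram}

/-- The filling uses precisely `μ_v` copies of `v` for `1 ≤ v ≤ M` (where `μ_v` is `μ (v - 1)`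
in the indexing by `Fin M`) and no other values. -/
def HasContent {M : ℕ} (t : Filling Y) (μ : Fin M → ℕ) : Prop :=
  (∀ c ∈ Y.cells, t.entry c.1 c.2 ≤ M) ∧
    ∀ v : Fin M, (Y.cells.filter (fun c => t.entry c.1 c.2 = (v : ℕ) + 1)).card = μ v

/-- Entries strictly increase from left to right in each row. -/
def RowStandard (t : Filling Y) : Prop :=
  ∀ i j₁ j₂, j₁ < j₂ → (i, j₂) ∈ Y → t.entry i j₁ < t.entry i j₂

/-- Entries weakly increase from top to bottom in each column. -/
def ColSemistandard (t : Filling Y) : Prop :=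
  ∀ i₁ i₂ j, i₁ < i₂ → (i₂, j) ∈ Y → t.entry i₁ j ≤ t.entry i₂ j

/-- The set `S(Y, μ)` of semistandard Young tableaux: row-standard and column-semistandard. -/
def semistandardTableaux (Y : YoungDiagram) {M : ℕ} (μ : Fin M → ℕ) : Set (Filling Y) :=
  {t | RowStandard t ∧ ColSemistandard t ∧ HasContent t μ}

/-- The entries of rows `p` and `q` in column `j` (in this order) form an inversion pair: the
former is smaller, and, for some `n`, the entries of the two rows `k` boxes to the right exist and
agree for `1 ≤ k ≤ n`, while `n + 1` boxes to the right either one of the entries is missing and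
row `p` lies below row `q`, or both exist and the one in row `p` is larger. -/
def IsInversionPair (t : Filling Y) (j p q : ℕ) : Prop :=
  (p, j) ∈ Y ∧ (q, j) ∈ Y ∧ t.entry p j < t.entry q j ∧
    ∃ n : ℕ,
      (∀ k, 1 ≤ k → k ≤ n →
        (p, j + k) ∈ Y ∧ (q, j + k) ∈ Y ∧ t.entry p (j + k) = t.entry q (j + k)) ∧
      ((((p, j + (n + 1)) ∉ Y ∨ (q, j + (n + 1)) ∉ Y) ∧ q < p) ∨
        ((p, j + (n + 1)) ∈ Y ∧ (q, j + (n + 1)) ∈ Y ∧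
          t.entry q (j + (n + 1)) < t.entry p (j + (n + 1))))

open Classical in
/-- The number of inversion pairs, counted as pairs of cells in the same column. -/
noncomputable def inv (t : Filling Y) : ℕ :=
  ((Y.cells ×ˢ Y.cells).filter
    (fun c => c.1.2 = c.2.2 ∧ IsInversionPair t c.1.2 c.1.1 c.2.1)).card

/-- The set `S_k(Y, μ)` of `k`-inverted semistandard Young tableaux. -/
def invertedTableaux (Y : YoungDiagram) {M : ℕ} (μ : Fin M → ℕ) (k : ℕ) : Set (Filling Y) :=
  {t | RowStandard t ∧ HasContent t μ ∧ inv t = k}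

/-- The standardization `st(t)`: every column is reordered to be weakly increasing from top to
bottom. It is given as an array of numbers, with `0` outside `Y`. -/
def standardization (t : Filling Y) (i j : ℕ) : ℕ :=
  (((Y.col j).val.map (fun c => t.entry c.1 c.2)).sort (· ≤ ·)).getD i 0

/-- The set `S_k^T(Y, μ)` of `k`-inverted semistandard Young tableaux with standardization `T`. -/
def invertedTableauxOver {M : ℕ} (μ : Fin M → ℕ) (T : Filling Y) (k : ℕ) : Set (Filling Y) :=
  {t | t ∈ invertedTableaux Y μ k ∧ standardization t = T.entry}

/-- The generating function `χ^T(q) = ∑_k |S_k^T(Y, μ)| q^k`. -/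
noncomputable def chi {M : ℕ} (μ : Fin M → ℕ) (T : Filling Y) : ℚ⟦X⟧ :=
  PowerSeries.mk fun k => ((invertedTableauxOver μ T k).ncard : ℚ)

/-- The number of entries in column `j` that are `< v`. -/
def numLT (T : Filling Y) (j v : ℕ) : ℕ :=
  ((Y.col j).filter (fun c => T.entry c.1 c.2 < v)).card

/-- The number of entries in column `j` that are `≤ v` (`0` if there is no column `j`). -/
def numLE (T : Filling Y) (j v : ℕ) : ℕ :=
  ((Y.col j).filter (fun c => T.entry c.1 c.2 ≤ v)).card

/-- The number of entries in column `j` that are equal to `v`. -/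
def numEQ (T : Filling Y) (j v : ℕ) : ℕ :=
  ((Y.col j).filter (fun c => T.entry c.1 c.2 = v)).card

/-- The common inversion depth of the entries of value `v` in column `j`. -/
def depValue (T : Filling Y) (j v : ℕ) : ℤ :=
  (numLT T j v : ℤ) - (numLE T (j + 1) v : ℤ)

/-- The (standard) inversion depth of the entry in cell `c`. -/
def dep (T : Filling Y) (c : ℕ × ℕ) : ℤ :=
  depValue T c.2 (T.entry c.1 c.2)

/-- The modified inversion depth of the entry in cell `c`: the number of entries above it in its
column minus the number of entries in the next column that are at most as large. -/
def depm (T : Filling Y) (c : ℕ × ℕ) : ℤ :=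
  (((Y.col c.2).filter (fun d => d.1 < c.1)).card : ℤ) -
    (numLE T (c.2 + 1) (T.entry c.1 c.2) : ℤ)

/-- The `q`-number `[p]_q = 1 + q + ⋯ + q^(p-1)`. -/
noncomputable def qNumber (p : ℕ) : ℚ⟦X⟧ :=
  ∑ i ∈ Finset.range p, PowerSeries.X ^ i

/-- The `q`-factorial `[p]_q! = [1]_q [2]_q ⋯ [p]_q`. -/
noncomputable def qFactorial (p : ℕ) : ℚ⟦X⟧ :=
  ∏ i ∈ Finset.range p, qNumber (i + 1)

/-- The `q`-binomial coefficient `[a]_q! / ([b]_q! [a-b]_q!)` for `b ≤ a`. The denominator has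
constant term `1`, so its inverse is a true inverse. -/
noncomputable def qBinomial (a b : ℕ) : ℚ⟦X⟧ :=
  qFactorial a * (qFactorial b * qFactorial (a - b))⁻¹

end InvTab

namespace InvTab

open PowerSeries

theorem constantCoeff_qNumber_succ (p : ℕ) : constantCoeff (qNumber (p + 1)) = 1 := by
  simp [qNumber, Finset.sum_range_succ', map_sum]

theorem qNumber_add (a b : ℕ) : qNumber (a + b) = qNumber a + X ^ a * qNumber b := by
  simp [qNumber, Finset.sum_range_add, Finset.mul_sum, pow_add]

theorem qFactorial_zero : qFactorial 0 = 1 := by simp [qFactorial]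

theorem qFactorial_succ (p : ℕ) : qFactorial (p + 1) = qFactorial p * qNumber (p + 1) := by
  simp [qFactorial, Finset.prod_range_succ]

theorem constantCoeff_qFactorial (p : ℕ) : constantCoeff (qFactorial p) = 1 := by
  simp [qFactorial, map_prod, constantCoeff_qNumber_succ]

theorem qFactorial_ne_zero (p : ℕ) : qFactorial p ≠ 0 := by
  intro h
  simpa [h] using constantCoeff_qFactorial p

theorem qBinomial_add_mul (a b : ℕ) :
    qBinomial (a + b) b * (qFactorial b * qFactorial a) = qFactorial (a + b) := by
  rw [qBinomial, Nat.add_sub_cancel, mul_assoc, PowerSeries.inv_mul_cancel, mul_one]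
  simp [constantCoeff_qFactorial]

theorem qBinomial_zero_right (a : ℕ) : qBinomial a 0 = 1 := by
  have h := qBinomial_add_mul a 0
  simpa [qFactorial_zero, qFactorial_ne_zero] using h

/-- The number of elements of `m` that are smaller than `v`. -/
def countLT (m : Multiset ℕ) (v : ℕ) : ℕ := m.countP (· < v)

/-- The number of elements of `b` that are at most `v`. -/
def countLE (b : List ℕ) (v : ℕ) : ℕ := b.countP (· ≤ v)

theorem countLT_zero (m : Multiset ℕ) : countLT m 0 = 0 := by
  simp [countLT]

theorem countLT_succ (m : Multiset ℕ) (v : ℕ) : countLT m (v + 1) = countLT m v + m.count v := by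
  induction m using Multiset.induction_on with
  | empty => simp [countLT]
  | cons a m ih =>
    simp only [countLT, Multiset.countP_cons, Multiset.count_cons] at ih ⊢
    split_ifs <;> omega

theorem countLT_cons (x : ℕ) (m : Multiset ℕ) (v : ℕ) :
    countLT (x ::ₘ m) v = countLT m v + if x < v then 1 else 0 := by
  simp [countLT, Multiset.countP_cons]

theorem sum_pow_countLT_mul_qNumber_count (m : Multiset ℕ) (K : ℕ) :
    ∑ x ∈ Finset.range K, X ^ countLT m x * qNumber (m.count x) = qNumber (countLT m K) := by
  induction K with
  | zero => simp [countLT_zero, qNumber]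
  | succ K ih => rw [Finset.sum_range_succ, ih, countLT_succ, qNumber_add]

/-- The `q`-multinomial coefficient of the elements of `m` smaller than `K`. -/
noncomputable def qMultinomial (m : Multiset ℕ) (K : ℕ) : ℚ⟦X⟧ :=
  ∏ v ∈ Finset.range K, qBinomial (countLT m v + m.count v) (m.count v)

theorem qMultinomial_mul (m : Multiset ℕ) (K : ℕ) :
    qMultinomial m K * ∏ v ∈ Finset.range K, qFactorial (m.count v) =
      qFactorial (countLT m K) := by
  induction K with
  | zero => simp [qMultinomial, countLT_zero, qFactorial_zero]
  | succ K ih =>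
    rw [qMultinomial, Finset.prod_range_succ, Finset.prod_range_succ, countLT_succ,
      ← qBinomial_add_mul, ← ih, qMultinomial]
    ring

theorem prod_qFactorial_count_erase (m : Multiset ℕ) {x K : ℕ} (hx : x ∈ m) (hK : x < K) :
    ∏ v ∈ Finset.range K, qFactorial (m.count v) =
      (∏ v ∈ Finset.range K, qFactorial ((m.erase x).count v)) * qNumber (m.count x) := by
  obtain ⟨m, rfl⟩ := Multiset.exists_cons_of_mem hx
  rw [Multiset.erase_cons_head, ← Finset.mul_prod_erase _ _ (Finset.mem_range.2 hK),
    ← Finset.mul_prod_erase (Finset.range K) (fun v => qFactorial (m.count v))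
      (Finset.mem_range.2 hK), Multiset.count_cons_self, qFactorial_succ]
  have : ∏ v ∈ (Finset.range K).erase x, qFactorial ((x ::ₘ m).count v) =
      ∏ v ∈ (Finset.range K).erase x, qFactorial (m.count v) :=
    Finset.prod_congr rfl fun v hv => by
      rw [Multiset.count_cons_of_ne (Finset.ne_of_mem_erase hv)]
  rw [this]
  ring

theorem sum_qMultinomial_erase (m : Multiset ℕ) (K : ℕ) (hK : 0 < countLT m K) :
    ∑ x ∈ (Finset.range K).filter (· ∈ m), X ^ countLT m x * qMultinomial (m.erase x) K =
      qMultinomial m K := by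
  have hD : ∏ v ∈ Finset.range K, qFactorial (m.count v) ≠ 0 :=
    Finset.prod_ne_zero_iff.2 fun v _ => qFactorial_ne_zero _
  apply mul_right_cancel₀ hD
  obtain ⟨n, hn⟩ := Nat.exists_eq_succ_of_ne_zero hK.ne'
  rw [qMultinomial_mul, hn, qFactorial_succ, ← Nat.succ_eq_add_one, ← hn,
    ← sum_pow_countLT_mul_qNumber_count, Finset.sum_mul, Finset.mul_sum, Finset.sum_filter]
  refine Finset.sum_congr rfl fun x hx => ?_
  have hx := Finset.mem_range.1 hx
  split_ifs with hm
  · have h1 : countLT (m.erase x) K = n := by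
      obtain ⟨m, rfl⟩ := Multiset.exists_cons_of_mem hm
      rw [countLT_cons, if_pos hx] at hn
      rw [Multiset.erase_cons_head]
      omega
    rw [prod_qFactorial_count_erase m hm hx, ← h1, ← qMultinomial_mul]
    ring
  · rw [Multiset.count_eq_zero_of_notMem hm]
    simp [qNumber]

/-- The words with content `m` whose letters are smaller than the corresponding entries of `b`. -/
def boundedWords : Multiset ℕ → List ℕ → Finset (List ℕ)
  | m, [] => if m = 0 then {[]} else ∅
  | m, b :: bs => (m.toFinset.filter (· < b)).biUnion fun x =>
      (boundedWords (m.erase x) bs).map ⟨List.cons x, List.cons_injective⟩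

theorem mem_boundedWords {m : Multiset ℕ} {b w : List ℕ} :
    w ∈ boundedWords m b ↔ (w : Multiset ℕ) = m ∧ List.Forall₂ (· < ·) w b := by
  induction b generalizing m w with
  | nil =>
    rw [boundedWords]
    split_ifs with h
    · subst h
      simp
    · simp only [Finset.notMem_empty, List.forall₂_nil_right_iff, false_iff, not_and]
      rintro h1 rfl
      exact h h1.symm
  | cons b bs ih =>
    simp only [boundedWords, Finset.mem_biUnion, Finset.mem_filter, Multiset.mem_toFinset,
      Finset.mem_map, Function.Embedding.coeFn_mk, ih, List.forall₂_cons_right_iff]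
    constructor
    · rintro ⟨x, ⟨hx, hb⟩, w, ⟨h1, h2⟩, rfl⟩
      refine ⟨?_, x, w, hb, h2, rfl⟩
      rw [← Multiset.cons_coe, h1, Multiset.cons_erase hx]
    · rintro ⟨rfl, x, w, hb, h2, rfl⟩
      exact ⟨x, ⟨by simp, hb⟩, w, ⟨by simp, h2⟩, rfl⟩

/-- The number of inversions of a word. -/
def wordInv : List ℕ → ℕ
  | [] => 0
  | x :: w => w.countP (· < x) + wordInv w

/-- The product of `q`-binomial coefficients counting the words in `boundedWords m b` by
inversions. -/
noncomputable def wordProduct (N : ℕ) (m : Multiset ℕ) (b : List ℕ) : ℚ⟦X⟧ :=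
  ∏ v ∈ Finset.range N, qBinomial (countLT m v - countLE b v + m.count v) (m.count v)

theorem sum_wordProduct_erase {N : ℕ} {m : Multiset ℕ} {b : ℕ} {bs : List ℕ}
    (hN : ∀ v ∈ m, v < N) (hb : ∀ c ∈ bs, b ≤ c) (hm : ∃ v ∈ m, v < b) :
    ∑ x ∈ m.toFinset.filter (· < b), X ^ countLT m x * wordProduct N (m.erase x) bs =
      wordProduct N m (b :: bs) := by
  have hle : ∀ v < b, countLE (b :: bs) v = 0 ∧ countLE bs v = 0 := by
    intro v hv
    simp only [countLE, List.countP_eq_zero, List.mem_cons, decide_eq_true_eq, not_le]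
    exact ⟨by rintro c (rfl | hc); exacts [hv, hv.trans_le (hb c hc)],
      fun c hc => hv.trans_le (hb c hc)⟩
  have hsplit : ∀ (m' : Multiset ℕ) (b' : List ℕ), (∀ v < b, countLE b' v = 0) →
      wordProduct N m' b' = qMultinomial m' (min b N) *
        ∏ v ∈ Finset.Ico (min b N) N,
          qBinomial (countLT m' v - countLE b' v + m'.count v) (m'.count v) := by
    intro m' b' h
    rw [wordProduct, ← Finset.prod_range_mul_prod_Ico _ (min_le_right b N), qMultinomial]
    congr 1
    refine Finset.prod_congr rfl fun v hv => ?_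
    rw [h v ((Finset.mem_range.1 hv).trans_le (min_le_left _ _)), Nat.sub_zero]
  rw [hsplit m _ fun v hv => (hle v hv).1]
  have hpos : 0 < countLT m (min b N) := by
    obtain ⟨v, hv, hvb⟩ := hm
    exact Multiset.countP_pos.2 ⟨v, hv, lt_min hvb (hN v hv)⟩
  rw [← sum_qMultinomial_erase m _ hpos, Finset.sum_mul]
  refine Finset.sum_congr ?_ fun x hx => ?_
  · ext x
    simp only [Finset.mem_filter, Multiset.mem_toFinset, Finset.mem_range, lt_min_iff]
    exact ⟨fun h => ⟨⟨h.2, hN x h.1⟩, h.1⟩, fun h => ⟨h.2, h.1.1⟩⟩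
  · simp only [Finset.mem_filter, Finset.mem_range, lt_min_iff] at hx
    rw [hsplit _ _ fun v hv => (hle v hv).2, mul_assoc]
    congr 2
    refine Finset.prod_congr rfl fun v hv => ?_
    rw [Finset.mem_Ico, min_le_iff] at hv
    have hbv : b ≤ v := by omega
    obtain ⟨m, rfl⟩ := Multiset.exists_cons_of_mem hx.2
    rw [Multiset.erase_cons_head, countLT_cons, if_pos (by omega),
      Multiset.count_cons_of_ne (by omega), countLE, countLE, List.countP_cons,
      if_pos (by simpa using hbv), Nat.add_sub_add_right]

theorem sum_boundedWords {N : ℕ} {m : Multiset ℕ} {b : List ℕ} (hN : ∀ v ∈ m, v < N)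
    (hb : b.Pairwise (· ≤ ·)) (hcard : m.card = b.length)
    (hle : ∀ v ∈ m, countLE b v ≤ countLT m v) :
    ∑ w ∈ boundedWords m b, X ^ wordInv w = wordProduct N m b := by
  induction b generalizing m with
  | nil =>
    obtain rfl : m = 0 := by simpa using hcard
    simp [boundedWords, wordInv, wordProduct, qBinomial_zero_right]
  | cons b bs ih =>
    rw [List.pairwise_cons] at hb
    have hex : ∃ v ∈ m, v < b := by
      have hne : m.toFinset.Nonempty := by
        rw [Multiset.toFinset_nonempty]
        rintro rfl
        simp at hcard
      refine ⟨m.toFinset.min' hne, Multiset.mem_toFinset.1 (Finset.min'_mem _ _), ?_⟩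
      have h0 : countLT m (m.toFinset.min' hne) = 0 := by
        rw [countLT, Multiset.countP_eq_zero]
        exact fun v hv => not_lt.2 (Finset.min'_le _ _ (Multiset.mem_toFinset.2 hv))
      have h1 := hle _ (Multiset.mem_toFinset.1 (Finset.min'_mem _ hne))
      rw [h0, Nat.le_zero, countLE, List.countP_eq_zero] at h1
      exact not_le.1 fun h => h1 b (by simp) (decide_eq_true h)
    rw [← sum_wordProduct_erase hN hb.1 hex, boundedWords, Finset.sum_biUnion]
    · refine Finset.sum_congr rfl fun x hx => ?_
      rw [Finset.mem_filter, Multiset.mem_toFinset] at hx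
      have hlt : ∀ v, countLT m v = countLT (m.erase x) v + if x < v then 1 else 0 := by
        intro v
        rw [← countLT_cons, Multiset.cons_erase hx.1]
      rw [← ih (fun v hv => hN v (Multiset.mem_of_mem_erase hv)) hb.2
        (by rw [Multiset.card_erase_of_mem hx.1, hcard]; rfl) ?_, Finset.sum_map, Finset.mul_sum]
      · refine Finset.sum_congr rfl fun w hw => ?_
        have hw := (mem_boundedWords.1 hw).1
        rw [Function.Embedding.coeFn_mk, wordInv, pow_add, hlt x, if_neg (lt_irrefl x), add_zero,
          ← hw, countLT, Multiset.coe_countP]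
      · intro v hv
        have h1 := hle v (Multiset.mem_of_mem_erase hv)
        rw [hlt v, countLE, List.countP_cons] at h1
        rw [countLE]
        by_cases hbv : b ≤ v
        · rw [if_pos (by simpa using hbv), if_pos (by omega)] at h1
          omega
        · have : bs.countP (· ≤ v) = 0 := by
            rw [List.countP_eq_zero]
            intro c hc
            have := hb.1 c hc
            simp only [decide_eq_true_eq]
            omega
          omega
    · intro x _ y _ hxy
      rw [Function.onFun, Finset.disjoint_left]
      intro w hw hw'
      obtain ⟨w1, -, rfl⟩ := Finset.mem_map.1 hw
      obtain ⟨w2, -, h⟩ := Finset.mem_map.1 hw'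
      simp only [Function.Embedding.coeFn_mk, List.cons.injEq] at h
      exact hxy h.1.symm

/-- The array `f` on `Y`, continued outside of `Y` by the large values `B + p` in row `p`. -/
def extendArray (Y : YoungDiagram) (B : ℕ) (f : ℕ → ℕ → ℕ) (p k : ℕ) : ℕ :=
  open Classical in if (p, k) ∈ Y then f p k else B + p

/-- The part of row `p` to the right of column `j`; the lexicographic order on these governs
the inversion pairs in column `j`. -/
def rowKey (Y : YoungDiagram) (B : ℕ) (f : ℕ → ℕ → ℕ) (j p : ℕ) : Lex (ℕ → ℕ) :=
  toLex fun k => extendArray Y B f p (j + 1 + k)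

theorem rowKey_congr {Y : YoungDiagram} {B : ℕ} {f g : ℕ → ℕ → ℕ} {j : ℕ}
    (h : ∀ i k, j < k → f i k = g i k) : rowKey Y B f j = rowKey Y B g j := by
  funext p
  simp only [rowKey, extendArray]
  congr 1
  funext k
  rw [h p _ (by omega)]

theorem notMem_of_rowLen_le {Y : YoungDiagram} {i j : ℕ} (h : Y.rowLen 0 ≤ j) : (i, j) ∉ Y := by
  rw [YoungDiagram.mem_iff_lt_rowLen, not_lt]
  exact (Y.rowLen_anti 0 i (Nat.zero_le i)).trans h

theorem rowKey_injective (Y : YoungDiagram) (B : ℕ) (f : ℕ → ℕ → ℕ) (j : ℕ) :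
    Function.Injective (rowKey Y B f j) := by
  intro p q h
  have h1 := congrFun (toLex.injective h) (Y.rowLen 0)
  rwa [extendArray, extendArray, if_neg (notMem_of_rowLen_le (by omega)),
    if_neg (notMem_of_rowLen_le (by omega)), Nat.add_left_cancel_iff] at h1

theorem rowKey_lt_iff {Y : YoungDiagram} {B : ℕ} {f : ℕ → ℕ → ℕ} {j p q : ℕ} :
    rowKey Y B f j p < rowKey Y B f j q ↔ ∃ n,
      (∀ k < n, extendArray Y B f p (j + 1 + k) = extendArray Y B f q (j + 1 + k)) ∧
        extendArray Y B f p (j + 1 + n) < extendArray Y B f q (j + 1 + n) :=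
  Iff.rfl

open Classical in
/-- The rows meeting column `j`, ordered by their parts to the right of column `j`. -/
noncomputable def rowOrder (Y : YoungDiagram) (B : ℕ) (f : ℕ → ℕ → ℕ) (j : ℕ) : List ℕ :=
  (List.range (Y.colLen j)).insertionSort fun p q => rowKey Y B f j p ≤ rowKey Y B f j q

theorem rowOrder_congr {Y : YoungDiagram} {B : ℕ} {f g : ℕ → ℕ → ℕ} {j : ℕ}
    (h : ∀ i k, j < k → f i k = g i k) : rowOrder Y B f j = rowOrder Y B g j := by
  rw [rowOrder, rowOrder, rowKey_congr h]

theorem rowOrder_perm (Y : YoungDiagram) (B : ℕ) (f : ℕ → ℕ → ℕ) (j : ℕ) :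
    (rowOrder Y B f j).Perm (List.range (Y.colLen j)) :=
  List.perm_insertionSort _ _

theorem nodup_rowOrder (Y : YoungDiagram) (B : ℕ) (f : ℕ → ℕ → ℕ) (j : ℕ) :
    (rowOrder Y B f j).Nodup :=
  (rowOrder_perm Y B f j).nodup_iff.2 List.nodup_range

theorem mem_rowOrder {Y : YoungDiagram} {B : ℕ} {f : ℕ → ℕ → ℕ} {j p : ℕ} :
    p ∈ rowOrder Y B f j ↔ (p, j) ∈ Y := by
  rw [(rowOrder_perm Y B f j).mem_iff, List.mem_range, YoungDiagram.mem_iff_lt_colLen]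

theorem pairwise_rowOrder (Y : YoungDiagram) (B : ℕ) (f : ℕ → ℕ → ℕ) (j : ℕ) :
    (rowOrder Y B f j).Pairwise fun p q => rowKey Y B f j p < rowKey Y B f j q := by
  classical
  have : Std.Total fun p q => rowKey Y B f j p ≤ rowKey Y B f j q := ⟨fun _ _ => le_total _ _⟩
  have : IsTrans ℕ fun p q => rowKey Y B f j p ≤ rowKey Y B f j q := ⟨fun _ _ _ => le_trans⟩
  have h : (rowOrder Y B f j).Pairwise fun p q => rowKey Y B f j p ≤ rowKey Y B f j q :=
    List.pairwise_insertionSort _ _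
  exact (h.and (nodup_rowOrder Y B f j)).imp fun h =>
    h.1.lt_of_ne fun he => h.2 (rowKey_injective _ _ _ _ he)

/-- The bounds that the column to the right imposes on column `j`, in the order `rowOrder`. -/
noncomputable def rowBounds (Y : YoungDiagram) (B : ℕ) (f : ℕ → ℕ → ℕ) (j : ℕ) : List ℕ :=
  (rowOrder Y B f j).map fun p => extendArray Y B f p (j + 1)

theorem pairwise_rowBounds (Y : YoungDiagram) (B : ℕ) (f : ℕ → ℕ → ℕ) (j : ℕ) :
    (rowBounds Y B f j).Pairwise (· ≤ ·) := by
  rw [rowBounds, List.pairwise_map]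
  refine (pairwise_rowOrder Y B f j).imp fun h => ?_
  obtain ⟨n, h1, h2⟩ := rowKey_lt_iff.1 h
  rcases n.eq_zero_or_pos with rfl | hn
  · exact h2.le
  · exact (h1 0 hn).le

/-- The number of pairs of rows `p`, `q` that form an inversion pair in column `j`. -/
noncomputable def colInv (Y : YoungDiagram) (B : ℕ) (f : ℕ → ℕ → ℕ) (j : ℕ) : ℕ :=
  open Classical in ((Finset.range (Y.colLen j) ×ˢ Finset.range (Y.colLen j)).filter
    fun c => f c.1 j < f c.2 j ∧ rowKey Y B f j c.2 < rowKey Y B f j c.1).card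

theorem colInv_congr {Y : YoungDiagram} {B : ℕ} {f g : ℕ → ℕ → ℕ} {j : ℕ}
    (h : ∀ i k, j ≤ k → f i k = g i k) : colInv Y B f j = colInv Y B g j := by
  classical
  rw [colInv, colInv, rowKey_congr fun i k hk => h i k hk.le]
  have hj : ∀ i, f i j = g i j := fun i => h i j le_rfl
  refine congrArg Finset.card (Finset.ext fun c => ?_)
  rw [Finset.mem_filter, Finset.mem_filter, hj, hj]

open Classical in
theorem card_filter_product_eq_wordInv {α : Type*} [LinearOrder α] (key : ℕ → α) (c : ℕ → ℕ)
    (l : List ℕ) (hl : l.Pairwise fun p q => key p < key q) :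
    ((l.toFinset ×ˢ l.toFinset).filter fun d => c d.1 < c d.2 ∧ key d.2 < key d.1).card =
      wordInv (l.map c) := by
  have hnd : l.Nodup := hl.imp fun h => by
    rintro rfl
    exact lt_irrefl _ h
  induction l with
  | nil => simp [wordInv]
  | cons r l ih =>
    rw [List.pairwise_cons] at hl
    rw [List.nodup_cons] at hnd
    have hr : r ∉ l.toFinset := by simpa using hnd.1
    have ih := ih hl.2 hnd.2
    rw [Finset.card_filter, Finset.sum_product_right] at ih ⊢
    rw [List.toFinset_cons, Finset.sum_insert hr, List.map_cons, wordInv, ← ih]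
    congr 1
    · rw [Finset.sum_insert hr, if_neg (by simp), zero_add, List.countP_map,
        List.countP_eq_length_filter, ← List.toFinset_card_of_nodup (hnd.2.filter _),
        List.toFinset_filter, Finset.card_filter]
      refine Finset.sum_congr rfl fun p hp => ?_
      simp [hl.1 p (List.mem_toFinset.1 hp)]
    · refine Finset.sum_congr rfl fun p hp => ?_
      rw [Finset.sum_insert hr, if_neg, zero_add]
      exact fun h => h.2.asymm (hl.1 p (List.mem_toFinset.1 hp))

theorem colInv_eq_wordInv (Y : YoungDiagram) (B : ℕ) (f : ℕ → ℕ → ℕ) (j : ℕ) :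
    colInv Y B f j = wordInv ((rowOrder Y B f j).map (f · j)) := by
  classical
  rw [← card_filter_product_eq_wordInv _ _ _ (pairwise_rowOrder Y B f j),
    List.toFinset_eq_of_perm _ _ (rowOrder_perm Y B f j), List.toFinset_range, colInv]
  congr!

/-- The multiset of entries in column `j`. -/
def colEntries (Y : YoungDiagram) (f : ℕ → ℕ → ℕ) (j : ℕ) : Multiset ℕ :=
  (Multiset.range (Y.colLen j)).map (f · j)

theorem mem_colEntries {Y : YoungDiagram} {f : ℕ → ℕ → ℕ} {j v : ℕ} :
    v ∈ colEntries Y f j ↔ ∃ i, (i, j) ∈ Y ∧ f i j = v := by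
  simp [colEntries, YoungDiagram.mem_iff_lt_colLen]

/-- Arrays that vanish outside of `Y` and to the left of column `j`, and otherwise have strictly
increasing rows and the same column contents as `T`. -/
structure IsPartialArray (Y : YoungDiagram) (T : ℕ → ℕ → ℕ) (j : ℕ) (f : ℕ → ℕ → ℕ) : Prop where
  zero_left : ∀ i k, k < j → f i k = 0
  zero_outside : ∀ i k, (i, k) ∉ Y → f i k = 0
  colEntries_eq : ∀ k, j ≤ k → colEntries Y f k = colEntries Y T k
  row_lt : ∀ i k, j ≤ k → (i, k + 1) ∈ Y → f i k < f i (k + 1)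

theorem IsPartialArray.lt {Y : YoungDiagram} {T f : ℕ → ℕ → ℕ} {j B : ℕ}
    (hf : IsPartialArray Y T j f) (hT : ∀ i k, (i, k) ∈ Y → T i k < B) {i k : ℕ} (hk : j ≤ k)
    (hi : (i, k) ∈ Y) : f i k < B := by
  have h : f i k ∈ colEntries Y T k := hf.colEntries_eq k hk ▸ mem_colEntries.2 ⟨i, hi, rfl⟩
  obtain ⟨i', hi', h⟩ := mem_colEntries.1 h
  exact h ▸ hT i' k hi'

theorem finite_bounded_arrays (Y : YoungDiagram) (B : ℕ) :
    {f : ℕ → ℕ → ℕ | (∀ i k, (i, k) ∉ Y → f i k = 0) ∧ ∀ i k, f i k ≤ B}.Finite := by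
  let F : (ℕ → ℕ → ℕ) → (Y.cells → Fin (B + 1)) := fun f c => Fin.ofNat (B + 1) (f c.1.1 c.1.2)
  refine Set.Finite.of_finite_image (f := F) (Set.toFinite _) ?_
  intro f hf g hg hfg
  funext i k
  by_cases h : (i, k) ∈ Y
  · have h1 := congrArg Fin.val (congrFun hfg ⟨(i, k), (YoungDiagram.mem_cells _).2 h⟩)
    simp only [F, Fin.val_ofNat] at h1
    rwa [Nat.mod_eq_of_lt (Nat.lt_succ_of_le (hf.2 i k)),
      Nat.mod_eq_of_lt (Nat.lt_succ_of_le (hg.2 i k))] at h1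
  · rw [hf.1 i k h, hg.1 i k h]

theorem exists_bound (Y : YoungDiagram) (T : ℕ → ℕ → ℕ) :
    ∃ B, ∀ i k, (i, k) ∈ Y → T i k < B :=
  ⟨Y.cells.sup (fun c => T c.1 c.2) + 1, fun _ _ h => Nat.lt_succ_of_le
    (Finset.le_sup (f := fun c : ℕ × ℕ => T c.1 c.2) ((YoungDiagram.mem_cells _).2 h))⟩

theorem finite_isPartialArray (Y : YoungDiagram) (T : ℕ → ℕ → ℕ) (j : ℕ) :
    {f | IsPartialArray Y T j f}.Finite := by
  obtain ⟨B, hB⟩ := exists_bound Y T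
  refine (finite_bounded_arrays Y B).subset fun f hf => ⟨hf.zero_outside, fun i k => ?_⟩
  by_cases hk : j ≤ k
  · by_cases h : (i, k) ∈ Y
    · exact (hf.lt hB hk h).le
    · simp [hf.zero_outside i k h]
  · simp [hf.zero_left i k (not_le.1 hk)]

/-- The finite set of all arrays as in `IsPartialArray`. -/
noncomputable def partialArrays (Y : YoungDiagram) (T : ℕ → ℕ → ℕ) (j : ℕ) :
    Finset (ℕ → ℕ → ℕ) :=
  (finite_isPartialArray Y T j).toFinset

theorem mem_partialArrays {Y : YoungDiagram} {T : ℕ → ℕ → ℕ} {j : ℕ} {f : ℕ → ℕ → ℕ} :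
    f ∈ partialArrays Y T j ↔ IsPartialArray Y T j f := by
  simp [partialArrays]

/-- The array `f` with column `j` replaced by `c`. -/
def setCol (f : ℕ → ℕ → ℕ) (j : ℕ) (c : ℕ → ℕ) (i k : ℕ) : ℕ := if k = j then c i else f i k

theorem setCol_self (f : ℕ → ℕ → ℕ) (j : ℕ) (c : ℕ → ℕ) (i : ℕ) : setCol f j c i j = c i :=
  if_pos rfl

theorem setCol_of_ne (f : ℕ → ℕ → ℕ) {j k : ℕ} (c : ℕ → ℕ) (i : ℕ) (h : k ≠ j) :
    setCol f j c i k = f i k :=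
  if_neg h

theorem colEntries_congr {Y : YoungDiagram} {f g : ℕ → ℕ → ℕ} {j : ℕ}
    (h : ∀ i, f i j = g i j) : colEntries Y f j = colEntries Y g j := by
  simp only [colEntries, h]

theorem IsPartialArray.erase {Y : YoungDiagram} {T f : ℕ → ℕ → ℕ} {j : ℕ}
    (hf : IsPartialArray Y T j f) : IsPartialArray Y T (j + 1) (setCol f j 0) where
  zero_left i k hk := by
    by_cases h : k = j
    · rw [h, setCol_self, Pi.zero_apply]
    · rw [setCol_of_ne _ _ _ h, hf.zero_left i k (by omega)]
  zero_outside i k hk := by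
    by_cases h : k = j
    · rw [h, setCol_self, Pi.zero_apply]
    · rw [setCol_of_ne _ _ _ h, hf.zero_outside i k hk]
  colEntries_eq k hk := by
    rw [← hf.colEntries_eq k (by omega)]
    exact colEntries_congr fun i => setCol_of_ne _ _ _ (by omega)
  row_lt i k hk hi := by
    rw [setCol_of_ne _ _ _ (by omega), setCol_of_ne _ _ _ (by omega)]
    exact hf.row_lt i k (by omega) hi

theorem exists_map_eq_of_nodup {l w : List ℕ} (hl : l.Nodup) (h : l.length = w.length) :
    ∃ c : ℕ → ℕ, l.map c = w ∧ ∀ p ∉ l, c p = 0 := by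
  refine ⟨fun p => w.getD (l.idxOf p) 0, ?_, fun p hp => ?_⟩
  · refine List.ext_getElem (by simpa using h) fun i h1 h2 => ?_
    simp [hl.idxOf_getElem, h2]
  · change w.getD (l.idxOf p) 0 = 0
    rw [List.idxOf_eq_length hp, h, List.getD_eq_default _ _ le_rfl]

theorem coe_map_rowOrder (Y : YoungDiagram) (B : ℕ) (f : ℕ → ℕ → ℕ) (j : ℕ) (c : ℕ → ℕ) :
    (((rowOrder Y B f j).map c : List ℕ) : Multiset ℕ) =
      (Multiset.range (Y.colLen j)).map c := by
  rw [← Multiset.map_coe, Multiset.coe_eq_coe.2 (rowOrder_perm Y B f j), Multiset.coe_range]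

theorem countLE_rowBounds {Y : YoungDiagram} {B : ℕ} {f : ℕ → ℕ → ℕ} {j v : ℕ} (hv : v < B) :
    countLE (rowBounds Y B f j) v = (colEntries Y f (j + 1)).countP (· ≤ v) := by
  classical
  rw [countLE, ← Multiset.coe_countP, rowBounds, coe_map_rowOrder, colEntries,
    Multiset.countP_map, Multiset.countP_map]
  change ((Finset.range (Y.colLen j)).filter fun p => extendArray Y B f p (j + 1) ≤ v).card =
    ((Finset.range (Y.colLen (j + 1))).filter fun p => f p (j + 1) ≤ v).card
  refine congrArg Finset.card (Finset.ext fun p => ?_)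
  rw [Finset.mem_filter, Finset.mem_filter, Finset.mem_range, Finset.mem_range,
    ← YoungDiagram.mem_iff_lt_colLen, ← YoungDiagram.mem_iff_lt_colLen, extendArray]
  constructor
  · rintro ⟨h1, h2⟩
    split_ifs at h2 with h
    · exact ⟨h, h2⟩
    · omega
  · rintro ⟨h1, h2⟩
    exact ⟨Y.up_left_mem le_rfl (Nat.le_succ j) h1, by rwa [if_pos h1]⟩

/-- The generating function of column `j`. -/
noncomputable def colProduct (Y : YoungDiagram) (B : ℕ) (T : ℕ → ℕ → ℕ) (j : ℕ) : ℚ⟦X⟧ :=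
  ∏ v ∈ Finset.range B, qBinomial
    (countLT (colEntries Y T j) v - (colEntries Y T (j + 1)).countP (· ≤ v) +
      (colEntries Y T j).count v) ((colEntries Y T j).count v)

section

variable {Y : YoungDiagram} {B : ℕ} {T : ℕ → ℕ → ℕ}

theorem countP_le_countLT (hrow : ∀ i k, (i, k + 1) ∈ Y → T i k < T i (k + 1)) (j v : ℕ) :
    (colEntries Y T (j + 1)).countP (· ≤ v) ≤ countLT (colEntries Y T j) v := by
  classical
  rw [countLT, colEntries, colEntries, Multiset.countP_map, Multiset.countP_map]
  change ((Finset.range (Y.colLen (j + 1))).filter _).card ≤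
    ((Finset.range (Y.colLen j)).filter _).card
  refine Finset.card_le_card fun p => ?_
  simp only [Finset.mem_filter, Finset.mem_range, ← YoungDiagram.mem_iff_lt_colLen]
  exact fun h => ⟨Y.up_left_mem le_rfl (Nat.le_succ j) h.1, (hrow p j h.1).trans_le h.2⟩

open Classical in
theorem sum_fiber_colInv (hB : ∀ i k, (i, k) ∈ Y → T i k < B)
    (hrow : ∀ i k, (i, k + 1) ∈ Y → T i k < T i (k + 1)) {j : ℕ} {g : ℕ → ℕ → ℕ}
    (hg : IsPartialArray Y T (j + 1) g) :
    ∑ f ∈ partialArrays Y T j with setCol f j 0 = g, X ^ colInv Y B f j =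
      colProduct Y B T j := by
  have hagree : ∀ f, setCol f j 0 = g → ∀ i k, j < k → f i k = g i k := by
    rintro f rfl i k hk
    rw [setCol_of_ne _ _ _ hk.ne']
  have hent : ∀ v ∈ colEntries Y T j, v < B := by
    intro v hv
    obtain ⟨i, hi, rfl⟩ := mem_colEntries.1 hv
    exact hB i j hi
  have hw : ∑ w ∈ boundedWords (colEntries Y T j) (rowBounds Y B g j), X ^ wordInv w =
      colProduct Y B T j := by
    rw [sum_boundedWords hent (pairwise_rowBounds _ _ _ _), wordProduct, colProduct]
    · refine Finset.prod_congr rfl fun v hv => ?_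
      rw [countLE_rowBounds (Finset.mem_range.1 hv), hg.colEntries_eq _ le_rfl]
    · simp [colEntries, rowBounds, (rowOrder_perm Y B g j).length_eq]
    · intro v hv
      rw [countLE_rowBounds (hent v hv), hg.colEntries_eq _ le_rfl]
      exact countP_le_countLT hrow j v
  rw [← hw]
  refine Finset.sum_nbij (fun f => (rowOrder Y B g j).map (f · j)) ?_ ?_ ?_ ?_
  · intro f hf
    rw [Finset.mem_filter, mem_partialArrays] at hf
    rw [mem_boundedWords, coe_map_rowOrder, rowBounds, List.forall₂_map_left_iff,
      List.forall₂_map_right_iff, List.forall₂_same]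
    refine ⟨hf.1.colEntries_eq j le_rfl, fun p hp => ?_⟩
    rw [extendArray]
    split_ifs with h
    · rw [← hagree f hf.2 _ _ (Nat.lt_succ_self j)]
      exact hf.1.row_lt p j le_rfl h
    · exact (hf.1.lt hB le_rfl (mem_rowOrder.1 hp)).trans_le (Nat.le_add_right _ _)
  · intro f hf f' hf' h
    rw [Finset.mem_coe, Finset.mem_filter, mem_partialArrays] at hf hf'
    rw [List.map_inj_left] at h
    funext i k
    by_cases hk : k = j
    · subst hk
      by_cases hi : (i, k) ∈ Y
      · exact h i (mem_rowOrder.2 hi)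
      · rw [hf.1.zero_outside i k hi, hf'.1.zero_outside i k hi]
    · have h1 := congrFun (congrFun (hf.2.trans hf'.2.symm) i) k
      rwa [setCol_of_ne _ _ _ hk, setCol_of_ne _ _ _ hk] at h1
  · intro w hw
    rw [Finset.mem_coe, mem_boundedWords] at hw
    obtain ⟨c, rfl, hc⟩ := exists_map_eq_of_nodup (nodup_rowOrder Y B g j)
      (w := w) (by rw [hw.2.length_eq, rowBounds, List.length_map])
    rw [coe_map_rowOrder, rowBounds, List.forall₂_map_left_iff,
      List.forall₂_map_right_iff, List.forall₂_same] at hw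
    refine ⟨setCol g j c, ?_, by simp only [setCol_self]⟩
    rw [Finset.mem_coe, Finset.mem_filter, mem_partialArrays]
    refine ⟨⟨fun i k hk => ?_, fun i k hk => ?_, fun k hk => ?_, fun i k hk hi => ?_⟩, ?_⟩
    · rw [setCol_of_ne _ _ _ hk.ne, hg.zero_left i k (by omega)]
    · by_cases h : k = j
      · subst h
        rw [setCol_self, hc i (by rwa [mem_rowOrder])]
      · rw [setCol_of_ne _ _ _ h, hg.zero_outside i k hk]
    · by_cases h : k = j
      · subst h
        rw [← hw.1]
        simp only [colEntries, setCol_self]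
      · rw [← hg.colEntries_eq k (by omega)]
        exact colEntries_congr fun i => setCol_of_ne _ _ _ h
    · rw [setCol_of_ne g (k := k + 1) _ _ (by omega)]
      by_cases h : k = j
      · subst h
        have h1 := hw.2 i (mem_rowOrder.2 (Y.up_left_mem le_rfl (Nat.le_succ k) hi))
        rwa [extendArray, if_pos hi, ← setCol_self g k c i] at h1
      · rw [setCol_of_ne _ _ _ h]
        exact hg.row_lt i k (by omega) hi
    · funext i k
      by_cases h : k = j
      · subst h
        rw [setCol_self, hg.zero_left i k (Nat.lt_succ_self k), Pi.zero_apply]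
      · rw [setCol_of_ne _ _ _ h, setCol_of_ne _ _ _ h]
  · intro f hf
    rw [colInv_eq_wordInv, rowOrder_congr (hagree f (Finset.mem_filter.1 hf).2)]

theorem partialArrays_rowLen : partialArrays Y T (Y.rowLen 0) = {0} := by
  ext f
  rw [mem_partialArrays, Finset.mem_singleton]
  constructor
  · intro hf
    funext i k
    rcases lt_or_ge k (Y.rowLen 0) with h | h
    · exact hf.zero_left i k h
    · exact hf.zero_outside i k (notMem_of_rowLen_le h)
  · rintro rfl
    refine ⟨fun _ _ _ => rfl, fun _ _ _ => rfl, fun k hk => ?_, fun i k hk hi => ?_⟩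
    · have : Y.colLen k = 0 := by
        by_contra h
        exact notMem_of_rowLen_le hk (YoungDiagram.mem_iff_lt_colLen.2 (Nat.pos_of_ne_zero h))
      simp [colEntries, this]
    · exact absurd hi (notMem_of_rowLen_le (by omega))

theorem sum_partialArrays (hB : ∀ i k, (i, k) ∈ Y → T i k < B)
    (hrow : ∀ i k, (i, k + 1) ∈ Y → T i k < T i (k + 1)) {j : ℕ} (hj : j ≤ Y.rowLen 0) :
    ∑ f ∈ partialArrays Y T j, X ^ (∑ k ∈ Finset.Ico j (Y.rowLen 0), colInv Y B f k) =
      ∏ k ∈ Finset.Ico j (Y.rowLen 0), colProduct Y B T k := by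
  classical
  induction hj using Nat.decreasingInduction with
  | self => simp [partialArrays_rowLen]
  | @of_succ j hj ih =>
    rw [Finset.prod_eq_prod_Ico_succ_bot hj, ← ih, ← Finset.sum_fiberwise_of_maps_to
      (t := partialArrays Y T (j + 1)) (g := fun f => setCol f j 0)
      (fun f hf => mem_partialArrays.2 (mem_partialArrays.1 hf).erase), Finset.mul_sum]
    refine Finset.sum_congr rfl fun g hg => ?_
    rw [← sum_fiber_colInv hB hrow (mem_partialArrays.1 hg), Finset.sum_mul]
    refine Finset.sum_congr rfl fun f hf => ?_
    rw [Finset.sum_eq_sum_Ico_succ_bot hj, pow_add]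
    congr 2
    refine Finset.sum_congr rfl fun k hk => colInv_congr fun i k' hk' => ?_
    rw [← (Finset.mem_filter.1 hf).2, setCol_of_ne]
    have := (Finset.mem_Ico.1 hk).1
    omega

end

variable {Y : YoungDiagram}

theorem col_eq_map (Y : YoungDiagram) (j : ℕ) :
    Y.col j = (Finset.range (Y.colLen j)).map
      ⟨fun i => (i, j), fun _ _ h => (Prod.mk.inj h).1⟩ := by
  ext ⟨i, k⟩
  rw [YoungDiagram.mem_col_iff, YoungDiagram.mem_iff_lt_colLen]
  simp only [Finset.mem_map, Finset.mem_range]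
  constructor
  · rintro ⟨h, rfl⟩
    exact ⟨i, h, rfl⟩
  · rintro ⟨_, h, h'⟩
    obtain ⟨rfl, rfl⟩ := Prod.mk.inj h'
    exact ⟨h, rfl⟩

theorem map_col_val (Y : YoungDiagram) (f : ℕ → ℕ → ℕ) (j : ℕ) :
    (Y.col j).val.map (fun c => f c.1 c.2) = colEntries Y f j := by
  rw [col_eq_map, Finset.map_val, Multiset.map_map, colEntries]
  rfl

theorem card_filter_col (f : ℕ → ℕ → ℕ) (j : ℕ) (P : ℕ → Prop) [DecidablePred P] :
    ((Y.col j).filter (fun c => P (f c.1 c.2))).card = (colEntries Y f j).countP P := by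
  rw [← map_col_val, Multiset.countP_map]
  rfl

theorem numLT_eq (T : Filling Y) (j v : ℕ) :
    numLT T j v = countLT (colEntries Y T.entry j) v :=
  card_filter_col T.entry j (· < v)

theorem numLE_eq (T : Filling Y) (j v : ℕ) :
    numLE T j v = (colEntries Y T.entry j).countP (· ≤ v) :=
  card_filter_col T.entry j (· ≤ v)

theorem numEQ_eq (T : Filling Y) (j v : ℕ) :
    numEQ T j v = (colEntries Y T.entry j).count v := by
  rw [numEQ, card_filter_col T.entry j (· = v), Multiset.count]
  exact Multiset.countP_congr rfl fun x _ => propext eq_comm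

@[to_additive]
theorem prod_cells {M : Type*} [CommMonoid M] (Y : YoungDiagram) (F : ℕ × ℕ → M) :
    ∏ c ∈ Y.cells, F c =
      ∏ j ∈ Finset.range (Y.rowLen 0), ∏ i ∈ Finset.range (Y.colLen j), F (i, j) := by
  rw [← Finset.prod_fiberwise_of_maps_to (t := Finset.range (Y.rowLen 0)) (g := Prod.snd)]
  · refine Finset.prod_congr rfl fun j _ => ?_
    have : Y.cells.filter (fun c => c.2 = j) = Y.col j := rfl
    rw [this, col_eq_map, Finset.prod_map]
    rfl
  · rintro ⟨i, j⟩ h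
    by_contra hj
    exact notMem_of_rowLen_le (by simpa using hj) ((YoungDiagram.mem_cells _).1 h)

theorem card_filter_cells_eq (f : ℕ → ℕ → ℕ) (v : ℕ) :
    (Y.cells.filter (fun c => f c.1 c.2 = v)).card =
      ∑ j ∈ Finset.range (Y.rowLen 0), (colEntries Y f j).count v := by
  rw [Finset.card_filter, sum_cells]
  refine Finset.sum_congr rfl fun j _ => ?_
  rw [colEntries, Multiset.count_map, ← Finset.card_filter]
  simp only [eq_comm]
  rfl

theorem isInversionPair_iff {t : Filling Y} {B j p q : ℕ}
    (hB : ∀ i k, (i, k) ∈ Y → t.entry i k < B) :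
    IsInversionPair t j p q ↔ (p, j) ∈ Y ∧ (q, j) ∈ Y ∧ t.entry p j < t.entry q j ∧
      rowKey Y B t.entry j q < rowKey Y B t.entry j p := by
  rw [IsInversionPair]
  refine and_congr_right fun _ => and_congr_right fun _ => and_congr_right fun _ => ?_
  rw [rowKey_lt_iff]
  refine exists_congr fun n => ?_
  rw [show j + (n + 1) = j + 1 + n by omega]
  have hp : ∀ i k, t.entry i k < B ∨ (i, k) ∉ Y := fun i k => by
    by_cases h : (i, k) ∈ Y
    exacts [Or.inl (hB i k h), Or.inr h]
  constructor
  · rintro ⟨h1, h2⟩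
    refine ⟨fun k hk => ?_, ?_⟩
    · obtain ⟨ha, hb, hc⟩ := h1 (k + 1) (by omega) (by omega)
      rw [show j + (k + 1) = j + 1 + k by omega] at ha hb hc
      rw [extendArray, extendArray, if_pos ha, if_pos hb, hc]
    · rcases h2 with ⟨h2, hqp⟩ | ⟨h2, h3, h4⟩
      · have hpn : (p, j + 1 + n) ∉ Y := fun h =>
          h2.elim (fun h' => h' h) fun h' => h' (Y.up_left_mem hqp.le le_rfl h)
        rw [extendArray, extendArray, if_neg hpn]
        split_ifs with h
        · exact (hB _ _ h).trans_le (Nat.le_add_right _ _)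
        · omega
      · rwa [extendArray, extendArray, if_pos h2, if_pos h3]
  · rintro ⟨h1, h2⟩
    have hne : p ≠ q := by
      rintro rfl
      exact lt_irrefl _ h2
    refine ⟨fun k hk1 hkn => ?_, ?_⟩
    · have h := h1 (k - 1) (by omega)
      rw [show j + 1 + (k - 1) = j + k by omega, extendArray, extendArray] at h
      split_ifs at h with ha hb hb
      · exact ⟨hb, ha, h.symm⟩
      · have := hB _ _ ha
        omega
      · have := hB _ _ hb
        omega
      · omega
    · rw [extendArray, extendArray] at h2
      split_ifs at h2 with ha hb hb
      · exact Or.inr ⟨hb, ha, h2⟩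
      · refine Or.inl ⟨Or.inl hb, ?_⟩
        by_contra h
        exact hb (Y.up_left_mem (not_lt.1 h) le_rfl ha)
      · have := hB _ _ hb
        omega
      · exact Or.inl ⟨Or.inl hb, by omega⟩

theorem inv_eq_sum_colInv {t : Filling Y} {B : ℕ} (hB : ∀ i k, (i, k) ∈ Y → t.entry i k < B) :
    inv t = ∑ j ∈ Finset.range (Y.rowLen 0), colInv Y B t.entry j := by
  classical
  rw [inv, Finset.card_eq_sum_card_fiberwise (t := Finset.range (Y.rowLen 0))
    (f := fun c => c.1.2)]
  · refine Finset.sum_congr rfl fun j _ => ?_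
    rw [colInv]
    refine Finset.card_nbij' (fun c => (c.1.1, c.2.1)) (fun c => ((c.1, j), (c.2, j)))
      ?_ ?_ ?_ ?_
    · rintro ⟨⟨p, k⟩, ⟨q, l⟩⟩ h
      simp only [Finset.coe_filter, Finset.mem_filter, Set.mem_ofPred_eq,
        isInversionPair_iff hB] at h
      obtain ⟨⟨-, rfl, h1, h2, h3⟩, rfl⟩ := h
      simp only [Finset.coe_filter, Set.mem_ofPred_eq, Finset.mem_product, Finset.mem_range,
        ← YoungDiagram.mem_iff_lt_colLen]
      exact ⟨⟨h1, h2⟩, h3⟩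
    · rintro ⟨p, q⟩ h
      simp only [Finset.coe_filter, Set.mem_ofPred_eq, Finset.mem_product, Finset.mem_range,
        ← YoungDiagram.mem_iff_lt_colLen] at h
      simp only [Finset.coe_filter, Finset.mem_filter, Set.mem_ofPred_eq,
        isInversionPair_iff hB, Finset.mem_product, YoungDiagram.mem_cells]
      exact ⟨⟨h.1, trivial, h.1.1, h.1.2, h.2⟩, trivial⟩
    · rintro ⟨⟨p, k⟩, ⟨q, l⟩⟩ h
      simp only [Finset.coe_filter, Finset.mem_filter, Set.mem_ofPred_eq] at h
      obtain ⟨⟨-, rfl, -⟩, rfl⟩ := h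
      rfl
    · rintro ⟨p, q⟩ _
      rfl
  · rintro ⟨⟨p, k⟩, d⟩ h
    simp only [Finset.coe_filter, Set.mem_ofPred_eq, Finset.mem_product,
      YoungDiagram.mem_cells] at h
    rw [Finset.mem_coe, Finset.mem_range]
    by_contra hk
    exact notMem_of_rowLen_le (not_lt.1 hk) h.1.1

theorem standardization_eq_iff {t T : Filling Y} (hT : ColSemistandard T) :
    standardization t = T.entry ↔ ∀ j, colEntries Y t.entry j = colEntries Y T.entry j := by
  have hsort : ∀ j, (colEntries Y T.entry j).sort (· ≤ ·) =
      (List.range (Y.colLen j)).map (T.entry · j) := by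
    intro j
    refine List.Perm.eq_of_pairwise' (Multiset.pairwise_sort _ _) ?_ ?_
    · rw [List.pairwise_map]
      refine List.Pairwise.imp_of_mem (R := (· < ·)) (fun {a b} _ hb hab => ?_)
        List.pairwise_lt_range
      exact hT a b j hab (YoungDiagram.mem_iff_lt_colLen.2 (List.mem_range.1 hb))
    · rw [← Multiset.coe_eq_coe, Multiset.sort_eq, colEntries, ← Multiset.map_coe,
        Multiset.coe_range]
  constructor
  · intro h j
    have hcard : ((colEntries Y t.entry j).sort (· ≤ ·)).length = Y.colLen j := by
      simp [colEntries]
    rw [← Multiset.sort_eq (colEntries Y t.entry j) (· ≤ ·),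
      ← Multiset.sort_eq (colEntries Y T.entry j) (· ≤ ·), hsort j]
    congr 1
    refine List.ext_getElem (by simp [hcard]) fun i h1 h2 => ?_
    have h3 := congrFun (congrFun h i) j
    rw [standardization, map_col_val, List.getD_eq_getElem _ _ h1] at h3
    rw [h3]
    simp
  · intro h
    funext i j
    rw [standardization, map_col_val, h j, hsort j]
    by_cases hi : i < Y.colLen j
    · rw [List.getD_eq_getElem _ _ (by simpa using hi)]
      simp
    · rw [List.getD_eq_default _ _ (by simpa using hi),
        T.zeros i j (by rwa [YoungDiagram.mem_iff_lt_colLen])]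

theorem rowStandard_iff {t : Filling Y} :
    RowStandard t ↔ ∀ i k, (i, k + 1) ∈ Y → t.entry i k < t.entry i (k + 1) := by
  refine ⟨fun h i k => h i k (k + 1) (Nat.lt_succ_self k), fun h i j₁ j₂ hj => ?_⟩
  induction hj with
  | refl => exact h i j₁
  | @step k hk ih =>
    exact fun hm => (ih (Y.up_left_mem le_rfl (Nat.le_succ k) hm)).trans (h i k hm)

theorem isPartialArray_of_mem {M : ℕ} {μ : Fin M → ℕ} {T t : Filling Y} {k : ℕ}
    (hT : ColSemistandard T) (ht : t ∈ invertedTableauxOver μ T k) :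
    IsPartialArray Y T.entry 0 t.entry where
  zero_left _ _ h := absurd h (Nat.not_lt_zero _)
  zero_outside := t.zeros
  colEntries_eq k _ := (standardization_eq_iff hT).1 ht.2 k
  row_lt i k _ := rowStandard_iff.1 ht.1.1 i k

/-- The filling with the entries of a complete array that has the column contents of `T`. -/
def IsPartialArray.toFilling {T : Filling Y} {f : ℕ → ℕ → ℕ}
    (hf : IsPartialArray Y T.entry 0 f) : Filling Y where
  entry := f
  pos i j h := by
    have h1 : f i j ∈ colEntries Y T.entry j :=
      hf.colEntries_eq j (Nat.zero_le j) ▸ mem_colEntries.2 ⟨i, h, rfl⟩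
    obtain ⟨i', hi', h2⟩ := mem_colEntries.1 h1
    exact h2 ▸ T.pos i' j hi'
  zeros := hf.zero_outside
  noSkip i j h v hv hle := by
    have h1 : f i j ∈ colEntries Y T.entry j :=
      hf.colEntries_eq j (Nat.zero_le j) ▸ mem_colEntries.2 ⟨i, h, rfl⟩
    obtain ⟨i', hi', h2⟩ := mem_colEntries.1 h1
    obtain ⟨a, b, hab, h3⟩ := T.noSkip i' j hi' v hv (h2 ▸ hle)
    have h4 : v ∈ colEntries Y f b :=
      hf.colEntries_eq b (Nat.zero_le b) ▸ mem_colEntries.2 ⟨a, hab, h3⟩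
    obtain ⟨c, hc, h5⟩ := mem_colEntries.1 h4
    exact ⟨c, b, hc, h5⟩

theorem IsPartialArray.toFilling_mem {M : ℕ} {μ : Fin M → ℕ} {T : Filling Y} {f : ℕ → ℕ → ℕ}
    (hf : IsPartialArray Y T.entry 0 f) (hT : T ∈ semistandardTableaux Y μ) :
    hf.toFilling ∈ invertedTableauxOver μ T (inv hf.toFilling) := by
  refine ⟨⟨rowStandard_iff.2 fun i k => hf.row_lt i k (Nat.zero_le k), ⟨?_, ?_⟩, rfl⟩,
    (standardization_eq_iff hT.2.1).2 fun j => hf.colEntries_eq j (Nat.zero_le j)⟩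
  · rintro ⟨i, j⟩ hc
    refine Nat.lt_succ_iff.1 (hf.lt (B := M + 1) (fun i k h => Nat.lt_succ_of_le ?_)
      (Nat.zero_le j) ((YoungDiagram.mem_cells _).1 hc))
    exact hT.2.2.1 (i, k) ((YoungDiagram.mem_cells _).2 h)
  · intro v
    rw [← hT.2.2.2 v, card_filter_cells_eq, card_filter_cells_eq]
    exact Finset.sum_congr rfl fun j _ => by
      rw [← hf.colEntries_eq j (Nat.zero_le j)]
      rfl

theorem entry_injective : Function.Injective (Filling.entry (Y := Y)) :=
  fun _ _ h => Filling.ext h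

theorem finite_iUnion_invertedTableauxOver {M : ℕ} (μ : Fin M → ℕ) {T : Filling Y}
    (hT : ColSemistandard T) : (⋃ k, invertedTableauxOver μ T k).Finite := by
  refine Set.Finite.of_finite_image (f := Filling.entry) ?_ entry_injective.injOn
  refine (finite_isPartialArray Y T.entry 0).subset ?_
  rintro _ ⟨t, ht, rfl⟩
  obtain ⟨k, hk⟩ := Set.mem_iUnion.1 ht
  exact isPartialArray_of_mem hT hk

theorem chi_eq_sum {M : ℕ} {μ : Fin M → ℕ} {T : Filling Y} (hT : T ∈ semistandardTableaux Y μ)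
    {B : ℕ} (hB : ∀ i k, (i, k) ∈ Y → T.entry i k < B) :
    chi μ T = ∑ f ∈ partialArrays Y T.entry 0,
      X ^ (∑ k ∈ Finset.range (Y.rowLen 0), colInv Y B f k) := by
  ext k
  rw [chi, coeff_mk, map_sum]
  simp only [coeff_X_pow]
  rw [Finset.sum_boole, ← Set.ncard_image_of_injective _ entry_injective, ← Set.ncard_coe_finset]
  congr 2
  ext f
  simp only [Set.mem_image, Finset.coe_filter, Set.mem_ofPred_eq, mem_partialArrays]
  constructor
  · rintro ⟨t, ht, rfl⟩
    have hp := isPartialArray_of_mem hT.2.1 ht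
    exact ⟨hp, by rw [← inv_eq_sum_colInv fun i k => hp.lt hB (Nat.zero_le k), ht.1.2.2]⟩
  · rintro ⟨hf, rfl⟩
    refine ⟨hf.toFilling, ?_, rfl⟩
    have h := hf.toFilling_mem hT
    rwa [inv_eq_sum_colInv (B := B) fun i k => hf.lt hB (Nat.zero_le k)] at h

theorem prod_qNumber_add (a c : ℕ) :
    ∏ s ∈ Finset.range c, qNumber (a + s + 1) = qBinomial (a + c) c * qFactorial c := by
  apply mul_right_cancel₀ (qFactorial_ne_zero a)
  rw [mul_assoc, qBinomial_add_mul, qFactorial, qFactorial, Finset.prod_range_add, mul_comm]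

theorem lt_countLT_iff {T : Filling Y} (hT : ColSemistandard T) {i j v : ℕ} :
    i < countLT (colEntries Y T.entry j) v ↔ (i, j) ∈ Y ∧ T.entry i j < v := by
  set s := (Finset.range (Y.colLen j)).filter fun i => T.entry i j < v with hs
  have hmem : ∀ i, i ∈ s ↔ (i, j) ∈ Y ∧ T.entry i j < v := fun i => by
    rw [hs, Finset.mem_filter, Finset.mem_range, YoungDiagram.mem_iff_lt_colLen]
  have hcard : countLT (colEntries Y T.entry j) v = s.card := by
    rw [countLT, colEntries, Multiset.countP_map]
    rfl
  have hsub : s ⊆ Finset.range s.card := by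
    intro a ha
    rw [Finset.mem_range, ← Nat.succ_le_iff, ← Finset.card_range (Nat.succ a)]
    refine Finset.card_le_card fun b hb => ?_
    rw [hmem] at ha ⊢
    rcases (Nat.lt_succ_iff.1 (Finset.mem_range.1 hb)).eq_or_lt with rfl | hba
    · exact ha
    · exact ⟨Y.up_left_mem hba.le le_rfl ha.1, (hT b a j hba ha.1).trans_lt ha.2⟩
  rw [hcard, ← Finset.mem_range, ← Finset.eq_of_subset_of_card_le hsub (by simp), hmem]

theorem filter_entry_eq {T : Filling Y} (hT : ColSemistandard T) (j v : ℕ) :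
    (Finset.range (Y.colLen j)).filter (fun i => T.entry i j = v) =
      Finset.Ico (countLT (colEntries Y T.entry j) v)
        (countLT (colEntries Y T.entry j) v + (colEntries Y T.entry j).count v) := by
  ext i
  rw [Finset.mem_filter, Finset.mem_range, ← YoungDiagram.mem_iff_lt_colLen, Finset.mem_Ico,
    ← countLT_succ, lt_countLT_iff hT, ← not_lt, lt_countLT_iff hT]
  constructor
  · rintro ⟨h, rfl⟩
    exact ⟨fun h' => lt_irrefl _ h'.2, h, Nat.lt_succ_self _⟩
  · rintro ⟨h1, h2, h3⟩
    exact ⟨h2, le_antisymm (Nat.lt_succ_iff.1 h3) (not_lt.1 fun h => h1 ⟨h2, h⟩)⟩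

theorem depm_mk (T : Filling Y) {i j : ℕ} (h : (i, j) ∈ Y) :
    depm T (i, j) =
      (i : ℤ) - ((colEntries Y T.entry (j + 1)).countP (· ≤ T.entry i j) : ℕ) := by
  rw [depm, numLE_eq, col_eq_map, Finset.filter_map, Finset.card_map]
  have : (Finset.range (Y.colLen j)).filter
      ((fun d : ℕ × ℕ => d.1 < i) ∘ (fun a => (a, j))) = Finset.range i := by
    ext a
    have := YoungDiagram.mem_iff_lt_colLen.1 h
    simp only [Finset.mem_filter, Finset.mem_range, Function.comp_apply]
    omega
  congr 2
  exact (congrArg Finset.card this).trans (Finset.card_range i)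

theorem depValue_eq (T : Filling Y) (j v : ℕ) :
    depValue T j v = (countLT (colEntries Y T.entry j) v : ℤ) -
      ((colEntries Y T.entry (j + 1)).countP (· ≤ v) : ℕ) := by
  rw [depValue, numLT_eq, numLE_eq]

theorem dep_nonneg {T : Filling Y} (hT : RowStandard T) (c : ℕ × ℕ) : 0 ≤ dep T c := by
  have := countP_le_countLT (rowStandard_iff.1 hT) c.2 (T.entry c.1 c.2)
  rw [dep, depValue_eq]
  omega

theorem dep_le_depm {T : Filling Y} (hT : ColSemistandard T) {c : ℕ × ℕ} (hc : c ∈ Y) :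
    dep T c ≤ depm T c := by
  obtain ⟨i, j⟩ := c
  have : countLT (colEntries Y T.entry j) (T.entry i j) ≤ i := by
    rw [← not_lt, lt_countLT_iff hT]
    exact fun h => lt_irrefl _ h.2
  rw [dep, depValue_eq, depm_mk T hc]
  exact sub_le_sub_right (Int.ofNat_le.2 this) _

theorem colProduct_mul_prod {T : Filling Y} (hrow : RowStandard T) (hcol : ColSemistandard T)
    {B : ℕ} (hB : ∀ i k, (i, k) ∈ Y → T.entry i k < B) (j : ℕ) :
    colProduct Y B T.entry j *
        ∏ i ∈ Finset.range (Y.colLen j), qNumber (depm T (i, j) - dep T (i, j) + 1).toNat =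
      ∏ i ∈ Finset.range (Y.colLen j), qNumber (depm T (i, j) + 1).toNat := by
  have hmaps : ∀ i ∈ Finset.range (Y.colLen j), T.entry i j ∈ Finset.range B := fun i hi =>
    Finset.mem_range.2 (hB i j (YoungDiagram.mem_iff_lt_colLen.2 (Finset.mem_range.1 hi)))
  rw [← Finset.prod_fiberwise_of_maps_to hmaps, ← Finset.prod_fiberwise_of_maps_to hmaps,
    colProduct, ← Finset.prod_mul_distrib]
  refine Finset.prod_congr rfl fun v _ => ?_
  have hle := countP_le_countLT (rowStandard_iff.1 hrow) j v
  have hfil := filter_entry_eq hcol j v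
  have hdepm : ∀ i, i ∈ (Finset.range (Y.colLen j)).filter (fun i => T.entry i j = v) →
      depm T (i, j) = (i : ℤ) - ((colEntries Y T.entry (j + 1)).countP (· ≤ v) : ℕ) ∧
      dep T (i, j) = (countLT (colEntries Y T.entry j) v : ℤ) -
        ((colEntries Y T.entry (j + 1)).countP (· ≤ v) : ℕ) := by
    intro i hi
    rw [Finset.mem_filter, Finset.mem_range, ← YoungDiagram.mem_iff_lt_colLen] at hi
    rw [depm_mk T hi.1, dep, depValue_eq, hi.2]
    exact ⟨rfl, rfl⟩
  rw [hfil] at hdepm ⊢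
  rw [Finset.prod_Ico_eq_prod_range, Finset.prod_Ico_eq_prod_range, Nat.add_sub_cancel_left]
  set L := countLT (colEntries Y T.entry j) v
  set c := (colEntries Y T.entry j).count v
  set e := (colEntries Y T.entry (j + 1)).countP (· ≤ v)
  have hd : ∀ s < c, (depm T (L + s, j) - dep T (L + s, j) + 1).toNat = s + 1 ∧
      (depm T (L + s, j) + 1).toNat = L - e + s + 1 := by
    intro s hs
    obtain ⟨h1, h2⟩ := hdepm (L + s) (Finset.mem_Ico.2 ⟨by omega, by omega⟩)
    rw [h1, h2]
    omega
  refine Eq.trans ?_ ((prod_qNumber_add (L - e) c).symm.trans ?_)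
  · rw [qFactorial]
    congr 1
    exact Finset.prod_congr rfl fun s hs => by rw [(hd s (Finset.mem_range.1 hs)).1]
  · exact Finset.prod_congr rfl fun s hs => by rw [(hd s (Finset.mem_range.1 hs)).2]

theorem colProduct_eq {T : Filling Y} {B : ℕ} (hB : ∀ i k, (i, k) ∈ Y → T.entry i k < B)
    (j : ℕ) :
    colProduct Y B T.entry j = ∏ v ∈ (Y.col j).image (fun c => T.entry c.1 c.2),
      qBinomial ((depValue T j v).toNat + numEQ T j v) (numEQ T j v) := by
  symm
  rw [colProduct, Finset.prod_subset (s₂ := Finset.range B)]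
  · refine Finset.prod_congr rfl fun v _ => ?_
    rw [depValue_eq, numEQ_eq, Int.toNat_sub]
  · intro v hv
    obtain ⟨⟨i, k⟩, hc, rfl⟩ := Finset.mem_image.1 hv
    exact Finset.mem_range.2 (hB i k (YoungDiagram.mem_col_iff.1 hc).1)
  · intro v _ hv
    have : numEQ T j v = 0 := by
      rw [numEQ, Finset.card_eq_zero, Finset.filter_eq_empty_iff]
      exact fun c hc h => hv (Finset.mem_image.2 ⟨c, hc, h⟩)
    rw [this, qBinomial_zero_right]

theorem chi_eq_prod_colProduct {M : ℕ} {μ : Fin M → ℕ} {T : Filling Y}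
    (hT : T ∈ semistandardTableaux Y μ) {B : ℕ} (hB : ∀ i k, (i, k) ∈ Y → T.entry i k < B) :
    chi μ T = ∏ j ∈ Finset.range (Y.rowLen 0), colProduct Y B T.entry j := by
  rw [chi_eq_sum hT hB, Finset.range_eq_Ico]
  exact sum_partialArrays hB (rowStandard_iff.1 hT.1) (Nat.zero_le _)

end InvTab

open InvTab in
/-- The depths are non-negative (so `Int.toNat` below is harmless) and the set of all inverted
tableaux with standardization `T` is finite (so the cardinalities in `chi` are true ones, and
`chi` is a polynomial). The product in the denominator has constant term `1`. -/
theorem mainTheorem1 (Y : YoungDiagram) (M : ℕ) (μ : Fin M → ℕ) (T : Filling Y)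
    (hT : T ∈ semistandardTableaux Y μ) :
    (∀ c ∈ Y.cells, 0 ≤ dep T c ∧ dep T c ≤ depm T c) ∧
    (⋃ k, invertedTableauxOver μ T k).Finite ∧
    chi μ T =
      (∏ c ∈ Y.cells, qNumber (depm T c + 1).toNat) *
        (∏ c ∈ Y.cells, qNumber (depm T c - dep T c + 1).toNat)⁻¹ ∧
    chi μ T =
      ∏ j ∈ Finset.range (Y.rowLen 0),
        ∏ v ∈ (Y.col j).image (fun c => T.entry c.1 c.2),
          qBinomial ((depValue T j v).toNat + numEQ T j v) (numEQ T j v) := by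
  obtain ⟨B, hB⟩ := exists_bound Y T.entry
  have hdep : ∀ c ∈ Y.cells, 0 ≤ dep T c ∧ dep T c ≤ depm T c := fun c hc =>
    ⟨dep_nonneg hT.1 c, dep_le_depm hT.2.1 ((YoungDiagram.mem_cells _).1 hc)⟩
  refine ⟨hdep, finite_iUnion_invertedTableauxOver μ hT.2.1, ?_, ?_⟩
  · have hne : PowerSeries.constantCoeff
        (∏ c ∈ Y.cells, qNumber (depm T c - dep T c + 1).toNat) ≠ 0 := by
      rw [map_prod]
      refine Finset.prod_ne_zero_iff.2 fun c hc => ?_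
      obtain ⟨n, hn⟩ : ∃ n, (depm T c - dep T c + 1).toNat = n + 1 :=
        ⟨(depm T c - dep T c).toNat, by have := hdep c hc; omega⟩
      rw [hn, constantCoeff_qNumber_succ]
      exact one_ne_zero
    rw [PowerSeries.eq_mul_inv_iff_mul_eq hne, chi_eq_prod_colProduct hT hB, prod_cells,
      prod_cells, ← Finset.prod_mul_distrib]
    exact Finset.prod_congr rfl fun j _ => colProduct_mul_prod hT.1 hT.2.1 hB j
  · rw [chi_eq_prod_colProduct hT hB]
    exact Finset.prod_congr rfl fun j _ => colProduct_eq hB j
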